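/- Let $\mathsf{AP}$ be a countable set of atomic propositions, and let $\Phi_{\mathsf V}$ be the language $\phi ::= p \mid \bot \mid \neg\phi \mid (\phi\land\phi) \mid (\phi\rhd\phi)$ with $p\in\mathsf{AP}$, where $\lor,\to,\leftrightarrow$ are defined from $\neg,\land$ as usual. A formula is \emph{flat} if it contains no nested conditionals, that is, $\alpha$ and $\beta$ contain no $\rhd$ whenever $\alpha\rhd\beta$ is a subformula. Let $\Phi_{\mathsf{V}\text{-}\mathsf{1}}$ be the set of flat formulas. A \emph{relational model} is a tuple $M=(W,\Gamma,V)$ where $W$ is a nonempty set, $V:\mathsf{AP}\to\mathcal P(W)$, and for every $w\in W$, $\Gamma(w)=(W_w,<_w)$, where $W_w\subseteq W$ and $<_w$ is an irreflexive, transitive relation on $W_w$ that is almost connected (if $x<_w y$, then $x<_w z$ or $z<_w y$, for all $x,y,z\in W_w$). Truth $M,w\Vdash\phi$ is defined as usual for atoms and Boolean connectives, and $M,w\Vdash\phi\rhd\psi$ if and only if for every $u\in W_w$ with $M,u\Vdash\phi$ there is $v\in W_w$ with $M,v\Vdash\phi$ such that for every $z\in W_w$, if $v\not<_w z$ and $M,z\Vdash\phi$,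 then $M,z\Vdash\psi$. A formula is \emph{valid} if it is true at every state of every relational model. The axiomatic system $\mathsf V$ has as axioms all instances of propositional tautologies and all formulas of the forms (a) $\phi\rhd\phi$; (b) $((\phi\rhd\chi)\land(\phi\rhd\xi))\to(\phi\rhd(\chi\land\xi))$; (c) $(\phi\rhd\chi)\to(\phi\rhd(\chi\lor\xi))$; (d) $((\phi\rhd\psi)\land(\phi\rhd\chi))\to((\phi\land\psi)\rhd\chi)$; (e) $((\phi\rhd\chi)\land(\psi\rhd\chi))\to((\phi\lor\psi)\rhd\chi)$; (f) $(\neg(\phi\rhd\neg\psi)\land(\phi\rhd\chi))\to((\phi\land\psi)\rhd\chi)$; and as rules modus ponens, replacement of equivalent antecedents (from $\phi\leftrightarrow\psi$ infer $(\phi\rhd\chi)\leftrightarrow(\psi\rhd\chi)$), and replacement of equivalent consequents (from $\chi\leftrightarrow\xi$ infer $(\phi\rhd\chi)\leftrightarrow(\phi\rhd\xi)$). The system $\mathsf{V}\text{-}\mathsf{1}$ is the restriction of $\mathsf V$ to $\Phi_{\mathsf{V}\text{-}\mathsf{1}}$: its derivations are the derivations in $\mathsf V$ all of whose formulas are flat.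 \textbf{Theorem.} $\mathsf{V}\text{-}\mathsf{1}$ is sound and complete with respect to the set of valid formulas in $\Phi_{\mathsf{V}\text{-}\mathsf{1}}$: a flat formula is derivable in $\mathsf{V}\text{-}\mathsf{1}$ if and only if it is valid. -/

import Mathlib

universe u v

namespace VLogic

/-- The language `Φ_V` over a set `AP` of atomic propositions:
`φ ::= p | ⊥ | ¬φ | (φ ∧ φ) | (φ ▷ φ)`. -/
inductive Formula (AP : Type u) : Type u
  | atom : AP → Formula AP
  | bot : Formula AP
  | neg : Formula AP → Formula AP
  | and : Formula AP → Formula AP → Formula AP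
  | cond : Formula AP → Formula AP → Formula AP

namespace Formula

variable {AP : Type u}

/-- `φ ∨ ψ := ¬(¬φ ∧ ¬ψ)`. -/
def or (φ ψ : Formula AP) : Formula AP := neg (and (neg φ) (neg ψ))

/-- `φ → ψ := ¬(φ ∧ ¬ψ)`. -/
def imp (φ ψ : Formula AP) : Formula AP := neg (and φ (neg ψ))

/-- `φ ↔ ψ := (φ → ψ) ∧ (ψ → φ)`. -/
def iff (φ ψ : Formula AP) : Formula AP := and (imp φ ψ) (imp ψ φ)

/-- Formulas of propositional logic: no conditional occurs in them. -/
def IsPropositional : Formula AP → Prop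
  | atom _ => True
  | bot => True
  | neg φ => φ.IsPropositional
  | and φ ψ => φ.IsPropositional ∧ ψ.IsPropositional
  | cond _ _ => False

/-- Flat formulas: no conditional occurs inside a conditional. -/
def IsFlat : Formula AP → Prop
  | atom _ => True
  | bot => True
  | neg φ => φ.IsFlat
  | and φ ψ => φ.IsFlat ∧ ψ.IsFlat
  | cond φ ψ => φ.IsPropositional ∧ ψ.IsPropositional

/-- Truth-functional evaluation: atomic propositions and conditionals get their truth values
from the assignment `a`, the Boolean connectives are computed. -/
def TruthFunctional (a : Formula AP → Prop) : Formula AP → Prop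
  | atom p => a (atom p)
  | bot => False
  | neg φ => ¬ φ.TruthFunctional a
  | and φ ψ => φ.TruthFunctional a ∧ ψ.TruthFunctional a
  | cond φ ψ => a (cond φ ψ)

/-- Instances, in the language with conditionals, of the tautologies of propositional logic. -/
def IsTautology (φ : Formula AP) : Prop :=
  ∀ a : Formula AP → Prop, φ.TruthFunctional a

end Formula

open Formula in
/-- The axioms of the system `V`. -/
inductive IsAxiom {AP : Type u} : Formula AP → Prop
  | taut (φ : Formula AP) : φ.IsTautology → IsAxiom φ
  | refl (φ : Formula AP) : IsAxiom (cond φ φ)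
  | conj (φ χ ξ : Formula AP) :
      IsAxiom (imp (and (cond φ χ) (cond φ ξ)) (cond φ (and χ ξ)))
  | weaken (φ χ ξ : Formula AP) :
      IsAxiom (imp (cond φ χ) (cond φ (or χ ξ)))
  | cautious (φ ψ χ : Formula AP) :
      IsAxiom (imp (and (cond φ ψ) (cond φ χ)) (cond (and φ ψ) χ))
  | disj (φ ψ χ : Formula AP) :
      IsAxiom (imp (and (cond φ χ) (cond ψ χ)) (cond (or φ ψ) χ))
  | rational (φ ψ χ : Formula AP) :
      IsAxiom (imp (and (neg (cond φ (neg ψ))) (cond φ χ)) (cond (and φ ψ) χ))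

open Formula in
/-- Derivability in the restriction of the system `V` to a set `L` of formulas: the axioms are
those axioms of `V` that lie in `L`, and a rule of `V` may be applied when its premises and its
conclusion lie in `L`. Hence every formula of a derivation lies in `L`. -/
inductive Derivable {AP : Type u} (L : Set (Formula AP)) : Formula AP → Prop
  | ax (φ : Formula AP) : IsAxiom φ → φ ∈ L → Derivable L φ
  | mp (φ ψ : Formula AP) :
      Derivable L φ → Derivable L (imp φ ψ) → ψ ∈ L → Derivable L ψ
  | replaceAntecedent (φ ψ χ : Formula AP) :
      Derivable L (iff φ ψ) → iff (cond φ χ) (cond ψ χ) ∈ L →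
      Derivable L (iff (cond φ χ) (cond ψ χ))
  | replaceConsequent (φ χ ξ : Formula AP) :
      Derivable L (iff χ ξ) → iff (cond φ χ) (cond φ ξ) ∈ L →
      Derivable L (iff (cond φ χ) (cond φ ξ))

/-- Derivability in the full system `V`. -/
def DerivableV {AP : Type u} (φ : Formula AP) : Prop := Derivable Set.univ φ

/-- Derivability in `V-1`, the restriction of the system `V` to the flat formulas. -/
def DerivableV1 {AP : Type u} (φ : Formula AP) : Prop :=
  Derivable {ψ : Formula AP | ψ.IsFlat} φ

/-- Relational models `(W, Γ, V)`, where `Γ w = (W_w, <_w)` with `W_w = dom w ⊆ W` and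
`<_w = lt w` an irreflexive, transitive, almost connected relation on `W_w`. -/
structure Model (AP : Type u) (W : Type v) where
  dom : W → Set W
  lt : (w : W) → dom w → dom w → Prop
  val : AP → Set W
  lt_irrefl : ∀ (w : W) (x : dom w), ¬ lt w x x
  lt_trans : ∀ (w : W) (x y z : dom w), lt w x y → lt w y z → lt w x z
  lt_almost_connected : ∀ (w : W) (x y z : dom w), lt w x y → lt w x z ∨ lt w z y

/-- Truth of a formula at a state of a relational model. As `<_w` is almost connected, the
condition `¬ v <_w z` says that `z` ranks at least as low as `v` (below it or tied with it). -/
def Sat {AP : Type u} {W : Type v} (M : Model AP W) : W → Formula AP → Prop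
  | w, .atom p => w ∈ M.val p
  | _, .bot => False
  | w, .neg φ => ¬ Sat M w φ
  | w, .and φ ψ => Sat M w φ ∧ Sat M w ψ
  | w, .cond φ ψ =>
      ∀ u : M.dom w, Sat M u φ →
        ∃ v : M.dom w, Sat M v φ ∧
          ∀ z : M.dom w, ¬ M.lt w v z → Sat M z φ → Sat M z ψ

/-- A formula is valid if it is true at every state of every relational model. -/
def Valid {AP : Type u} (φ : Formula AP) : Prop :=
  ∀ (W : Type v) [Nonempty W] (M : Model AP W) (w : W), Sat M w φ

end VLogic

/-!
Soundness is a direct check of the axioms: the relation `¬ v <_w z` is a total preorder on `W_w`,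
so two witnesses for conditionals can always be replaced by the lower of the two.

For completeness, let `φ` be flat and not derivable. Zorn's lemma gives a set `T` of flat formulas
which contains the derivable ones, is closed under modus ponens, does not contain `φ`, and is
maximal with these properties; such a `T` decides every flat formula. The states of the
countermodel are the valuations of the finite set `A` of atoms of `φ`. Every set `X` of states is
defined by a propositional formula, and, by the replacement rules, whether `T` contains
`α ▷ β` depends only on the sets `X`, `Y` defined by `α` and `β`; this is the relation `Entails`.
As there are finitely many states, there is a least `Y` with `Entails X Y`, called `core X`, and
`Entails X Y` means `core X ⊆ Y`. The axioms of `V` say that `core` is a choice function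
satisfying Arrow's condition `core (X ∩ Y) = core X ∩ Y` whenever `core X` meets `Y`
(`RationalEntailment.core_inter`). Such a choice function picks the minimal elements for the
revealed preference `x < z ↔ z ∉ core {x, z}` on the states `x` with `core {x} ≠ ∅`. These states
and this relation, taken at every state of the model, make a conditional true exactly when it
belongs to `T` (`RationalEntailment.entails_iff`). Since conditionals are not nested, a single
ordering suffices: `φ` fails at the state given by the atoms in `T`.
-/

namespace VLogic

open Formula

/-! ### Soundness -/

section Soundness

variable {AP : Type u} {W : Type v}

lemma truthFunctional_sat (M : Model AP W) (w : W) (φ : Formula AP) :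
    φ.TruthFunctional (Sat M w) ↔ Sat M w φ := by
  induction φ with
  | atom p => rfl
  | bot => rfl
  | neg φ ih => simp only [TruthFunctional, Sat, ih]
  | and φ ψ ih₁ ih₂ => simp only [TruthFunctional, Sat, ih₁, ih₂]
  | cond φ ψ _ _ => rfl

@[simp] lemma sat_and (M : Model AP W) (w : W) (φ ψ : Formula AP) :
    Sat M w (and φ ψ) ↔ Sat M w φ ∧ Sat M w ψ := by
  simp only [Sat]

@[simp] lemma sat_neg (M : Model AP W) (w : W) (φ : Formula AP) :
    Sat M w (neg φ) ↔ ¬ Sat M w φ := by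
  simp only [Sat]

@[simp] lemma sat_or (M : Model AP W) (w : W) (φ ψ : Formula AP) :
    Sat M w (or φ ψ) ↔ Sat M w φ ∨ Sat M w ψ := by
  simp only [Formula.or, Sat]; tauto

@[simp] lemma sat_imp (M : Model AP W) (w : W) (φ ψ : Formula AP) :
    Sat M w (imp φ ψ) ↔ (Sat M w φ → Sat M w ψ) := by
  simp only [imp, Sat]; tauto

@[simp] lemma sat_iff (M : Model AP W) (w : W) (φ ψ : Formula AP) :
    Sat M w (iff φ ψ) ↔ (Sat M w φ ↔ Sat M w ψ) := by
  simp only [Formula.iff, sat_and, sat_imp]; tauto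

lemma sat_cond (M : Model AP W) (w : W) (φ ψ : Formula AP) :
    Sat M w (cond φ ψ) ↔ ∀ u : M.dom w, Sat M u φ → ∃ v : M.dom w, Sat M v φ ∧
      ∀ z : M.dom w, ¬ M.lt w v z → Sat M z φ → Sat M z ψ := by
  simp only [Sat]

/-- Transitivity of "ranks at least as low as". -/
lemma Model.not_lt_trans (M : Model AP W) (w : W) {x y z : M.dom w} (hxy : ¬ M.lt w x y)
    (hyz : ¬ M.lt w y z) : ¬ M.lt w x z :=
  fun h => (M.lt_almost_connected w x z y h).elim hxy hyz

/-- Of two elements, one ranks at least as low as both. -/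
lemma Model.exists_lower (M : Model AP W) (w : W) (x y : M.dom w) :
    ∃ v, (v = x ∨ v = y) ∧ ¬ M.lt w x v ∧ ¬ M.lt w y v := by
  by_cases h : M.lt w y x
  · exact ⟨y, .inr rfl, fun h' => M.lt_irrefl w _ (M.lt_trans w _ _ _ h h'), M.lt_irrefl w y⟩
  · exact ⟨x, .inl rfl, M.lt_irrefl w x, h⟩

lemma sat_of_isAxiom (M : Model AP W) (w : W) {φ : Formula AP} (h : IsAxiom φ) : Sat M w φ := by
  cases h with
  | taut _ h => exact (truthFunctional_sat M w φ).1 (h _)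
  | refl φ => exact (sat_cond ..).2 fun u hu => ⟨u, hu, fun _ _ h => h⟩
  | conj φ χ ξ =>
    simp only [sat_imp, sat_and, sat_cond]
    rintro ⟨h₁, h₂⟩ u hu
    obtain ⟨x, hx, hx'⟩ := h₁ u hu
    obtain ⟨y, hy, hy'⟩ := h₂ u hu
    obtain ⟨v, hv, hxv, hyv⟩ := M.exists_lower w x y
    refine ⟨v, by rcases hv with rfl | rfl <;> assumption, fun z hz hzφ => ⟨?_, ?_⟩⟩
    · exact hx' z (M.not_lt_trans w hxv hz) hzφ
    · exact hy' z (M.not_lt_trans w hyv hz) hzφ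
  | weaken φ χ ξ =>
    simp only [sat_imp, sat_or, sat_cond]
    intro h u hu
    obtain ⟨v, hv, hv'⟩ := h u hu
    exact ⟨v, hv, fun z hz hzφ => .inl (hv' z hz hzφ)⟩
  | cautious φ ψ χ =>
    simp only [sat_imp, sat_and, sat_cond]
    rintro ⟨h₁, h₂⟩ u ⟨hu, -⟩
    obtain ⟨x, hx, hx'⟩ := h₁ u hu
    obtain ⟨y, hy, hy'⟩ := h₂ u hu
    obtain ⟨v, hv, hxv, hyv⟩ := M.exists_lower w x y
    have hvφ : Sat M v φ := by rcases hv with rfl | rfl <;> assumption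
    exact ⟨v, ⟨hvφ, hx' v hxv hvφ⟩,
      fun z hz hzφ => hy' z (M.not_lt_trans w hyv hz) hzφ.1⟩
  | disj φ ψ χ =>
    simp only [sat_imp, sat_and, sat_or, sat_cond]
    rintro ⟨h₁, h₂⟩ u hu
    by_cases hφ : ∃ u : M.dom w, Sat M u φ
    · by_cases hψ : ∃ u : M.dom w, Sat M u ψ
      · obtain ⟨_, hφ⟩ := hφ
        obtain ⟨_, hψ⟩ := hψ
        obtain ⟨x, hx, hx'⟩ := h₁ _ hφ
        obtain ⟨y, hy, hy'⟩ := h₂ _ hψ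
        obtain ⟨v, hv, hxv, hyv⟩ := M.exists_lower w x y
        refine ⟨v, by rcases hv with rfl | rfl <;> tauto, fun z hz => ?_⟩
        rintro (h | h)
        · exact hx' z (M.not_lt_trans w hxv hz) h
        · exact hy' z (M.not_lt_trans w hyv hz) h
      · obtain ⟨_, hφ⟩ := hφ
        obtain ⟨x, hx, hx'⟩ := h₁ _ hφ
        exact ⟨x, .inl hx, fun z hz h => hx' z hz (h.resolve_right fun h => hψ ⟨z, h⟩)⟩
    · have huψ := hu.resolve_left fun h => hφ ⟨u, h⟩
      obtain ⟨y, hy, hy'⟩ := h₂ _ huψ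
      exact ⟨y, .inr hy, fun z hz h => hy' z hz (h.resolve_left fun h => hφ ⟨z, h⟩)⟩
  | rational φ ψ χ =>
    simp only [sat_imp, sat_and, sat_neg, sat_cond]
    rintro ⟨h₁, h₂⟩ u ⟨hu, -⟩
    obtain ⟨v, hv, hv'⟩ := h₂ u hu
    -- `v` does not witness `φ ▷ ¬ψ`, so some `φ ∧ ψ`-state ranks at least as low as `v`
    have : ∃ z : M.dom w, ¬ M.lt w v z ∧ Sat M z φ ∧ Sat M z ψ := by
      by_contra hne
      exact h₁ fun _ _ => ⟨v, hv, fun z hz hzφ hzψ => hne ⟨z, hz, hzφ, hzψ⟩⟩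
    obtain ⟨z, hz, hzφψ⟩ := this
    exact ⟨z, hzφψ, fun z' hz' h => hv' z' (M.not_lt_trans w hz hz') h.1⟩

/-- Soundness, for derivations in any set of formulas, hence for `V` as well as for `V-1`. -/
lemma sat_of_derivable (M : Model AP W) {L : Set (Formula AP)} {φ : Formula AP}
    (h : Derivable L φ) (w : W) : Sat M w φ := by
  induction h generalizing w with
  | ax φ h _ => exact sat_of_isAxiom M w h
  | mp φ ψ _ _ _ ih₁ ih₂ => exact (sat_imp ..).1 (ih₂ w) (ih₁ w)
  | replaceAntecedent φ ψ χ _ _ ih =>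
    have h w := (sat_iff ..).1 (ih w)
    simp only [sat_iff, sat_cond, h]
  | replaceConsequent φ χ ξ _ _ ih =>
    have h w := (sat_iff ..).1 (ih w)
    simp only [sat_iff, sat_cond, h]

end Soundness

/-! ### Maximal theories -/

section Theories

variable {AP : Type u}

namespace Formula

@[simp] lemma truthFunctional_or (a : Formula AP → Prop) (φ ψ : Formula AP) :
    (or φ ψ).TruthFunctional a ↔ φ.TruthFunctional a ∨ ψ.TruthFunctional a := by
  simp only [Formula.or, TruthFunctional]; tauto

@[simp] lemma truthFunctional_imp (a : Formula AP → Prop) (φ ψ : Formula AP) :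
    (imp φ ψ).TruthFunctional a ↔ (φ.TruthFunctional a → ψ.TruthFunctional a) := by
  simp only [imp, TruthFunctional]; tauto

@[simp] lemma truthFunctional_iff (a : Formula AP → Prop) (φ ψ : Formula AP) :
    (iff φ ψ).TruthFunctional a ↔ (φ.TruthFunctional a ↔ ψ.TruthFunctional a) := by
  simp only [Formula.iff, TruthFunctional, truthFunctional_imp]; tauto

@[simp] lemma isFlat_imp (φ ψ : Formula AP) : (imp φ ψ).IsFlat ↔ φ.IsFlat ∧ ψ.IsFlat := by
  simp only [imp, IsFlat]

@[simp] lemma isFlat_iff (φ ψ : Formula AP) : (iff φ ψ).IsFlat ↔ φ.IsFlat ∧ ψ.IsFlat := by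
  simp only [Formula.iff, IsFlat, isFlat_imp]; tauto

@[simp] lemma isPropositional_or (φ ψ : Formula AP) :
    (or φ ψ).IsPropositional ↔ φ.IsPropositional ∧ ψ.IsPropositional := by
  simp only [Formula.or, IsPropositional]

lemma IsPropositional.isFlat {φ : Formula AP} (h : φ.IsPropositional) : φ.IsFlat := by
  induction φ with
  | atom p => trivial
  | bot => trivial
  | neg φ ih => exact ih h
  | and φ ψ ih₁ ih₂ => exact ⟨ih₁ h.1, ih₂ h.2⟩
  | cond φ ψ _ _ => exact h.elim

end Formula

lemma DerivableV1.isFlat {φ : Formula AP} (h : DerivableV1 φ) : φ.IsFlat := by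
  cases h <;> assumption

/-- A theory of `V-1`: a set of flat formulas that contains the derivable ones and is closed
under modus ponens. Closure under the replacement rules is not required, as these preserve
derivability but not truth at a state. -/
structure IsTheory (T : Set (Formula AP)) : Prop where
  isFlat : ∀ {ψ}, ψ ∈ T → ψ.IsFlat
  of_derivable : ∀ {ψ}, DerivableV1 ψ → ψ ∈ T
  mp : ∀ {ψ χ}, ψ ∈ T → imp ψ χ ∈ T → χ ∈ T

namespace IsTheory

variable {T : Set (Formula AP)}

lemma of_isAxiom (hT : IsTheory T) {ψ : Formula AP} (h : IsAxiom ψ) (hψ : ψ.IsFlat) : ψ ∈ T :=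
  hT.of_derivable (.ax _ h hψ)

/-- Theories are closed under tautological consequence. -/
lemma of_truthFunctional₂ (hT : IsTheory T) {ψ₁ ψ₂ χ : Formula AP} (h₁ : ψ₁ ∈ T) (h₂ : ψ₂ ∈ T)
    (hχ : χ.IsFlat)
    (h : ∀ a, ψ₁.TruthFunctional a → ψ₂.TruthFunctional a → χ.TruthFunctional a) : χ ∈ T := by
  refine hT.mp h₂ (hT.mp h₁ (hT.of_isAxiom (.taut _ fun a => ?_) ?_))
  · simpa using h a
  · simp [hχ, hT.isFlat h₁, hT.isFlat h₂]

lemma of_truthFunctional (hT : IsTheory T) {ψ χ : Formula AP} (h : ψ ∈ T) (hχ : χ.IsFlat)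
    (h' : ∀ a, ψ.TruthFunctional a → χ.TruthFunctional a) : χ ∈ T :=
  hT.of_truthFunctional₂ h h hχ fun a ha _ => h' a ha

lemma and_mem (hT : IsTheory T) {ψ χ : Formula AP} (hψ : ψ ∈ T) (hχ : χ ∈ T) : and ψ χ ∈ T :=
  hT.of_truthFunctional₂ hψ hχ ⟨hT.isFlat hψ, hT.isFlat hχ⟩ fun _ h₁ h₂ => ⟨h₁, h₂⟩

/-- The theory generated by `T` and a further formula `ψ`. -/
lemma adjoin (hT : IsTheory T) {ψ : Formula AP} (hψ : ψ.IsFlat) :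
    IsTheory {χ | imp ψ χ ∈ T} where
  isFlat h := ((isFlat_imp ..).1 (hT.isFlat h)).2
  of_derivable h := hT.of_truthFunctional (hT.of_derivable h) (by simp [hψ, h.isFlat])
    fun a => by simp only [truthFunctional_imp]; tauto
  mp {χ ξ} h₁ h₂ := by
    have hf : ξ.IsFlat := by have := hT.isFlat h₂; simp at this; tauto
    exact hT.of_truthFunctional₂ h₁ h₂ (by simp [hψ, hf])
      fun a => by simp only [truthFunctional_imp]; tauto

end IsTheory

/-- A complete theory: a consistent theory that decides every flat formula. -/
structure IsCompleteTheory (T : Set (Formula AP)) : Prop extends IsTheory T where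
  neg_mem_iff : ∀ {ψ}, ψ.IsFlat → (neg ψ ∈ T ↔ ψ ∉ T)

/-- Lindenbaum's lemma. -/
lemma exists_isCompleteTheory {φ : Formula AP} (hφ : φ.IsFlat) (h : ¬ DerivableV1 φ) :
    ∃ T, IsCompleteTheory T ∧ φ ∉ T := by
  have h₀ : IsTheory {ψ : Formula AP | DerivableV1 ψ} :=
    ⟨DerivableV1.isFlat, id, fun {ψ χ} h₁ h₂ =>
      .mp ψ χ h₁ h₂ ((isFlat_imp ..).1 (DerivableV1.isFlat h₂)).2⟩
  obtain ⟨T, -, ⟨hT, hφT⟩, hmax⟩ := zorn_subset_nonempty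
    {T : Set (Formula AP) | IsTheory T ∧ φ ∉ T} (fun c hc hchain ⟨T₀, hT₀⟩ => by
      refine ⟨⋃₀ c, ⟨⟨?_, ?_, ?_⟩, ?_⟩, fun S hS => Set.subset_sUnion_of_mem hS⟩
      · rintro ψ ⟨S, hS, hψ⟩
        exact (hc hS).1.isFlat hψ
      · exact fun hψ => ⟨T₀, hT₀, (hc hT₀).1.of_derivable hψ⟩
      · rintro ψ χ ⟨S, hS, hψ⟩ ⟨S', hS', hψχ⟩
        rcases hchain.total hS hS' with hle | hle
        · exact ⟨S', hS', (hc hS').1.mp (hle hψ) hψχ⟩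
        · exact ⟨S, hS, (hc hS).1.mp hψ (hle hψχ)⟩
      · rintro ⟨S, hS, hφS⟩
        exact (hc hS).2 hφS) _ ⟨h₀, h⟩
  have key {ψ : Formula AP} (hψ : ψ.IsFlat) (hψT : ψ ∉ T) : imp ψ φ ∈ T := by
    by_contra hne
    have hle : T ⊆ {χ | imp ψ χ ∈ T} := fun χ hχ =>
      hT.of_truthFunctional hχ (by simp [hψ, hT.isFlat hχ])
        fun a => by simp only [truthFunctional_imp]; tauto
    refine hψT (hmax ⟨hT.adjoin hψ, hne⟩ hle ?_)
    exact hT.of_isAxiom (.taut _ fun a => by simp) (by simp [hψ])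
  refine ⟨T, ⟨hT, fun {ψ} hψ => ⟨fun hn hp => hφT ?_, fun hψT => ?_⟩⟩, hφT⟩
  · exact hT.of_truthFunctional₂ hn hp hφ fun a h₁ h₂ => (h₁ h₂).elim
  · by_contra hn
    refine hφT (hT.of_truthFunctional₂ (key hψ hψT) (key (ψ := neg ψ) hψ hn) hφ fun a => ?_)
    simp only [truthFunctional_imp, TruthFunctional]; tauto

end Theories

/-! ### Rational entailment between sets of states -/

/-- The axioms of `V`, read as properties of a relation between sets of states:
`N X Y` stands for a conditional with antecedent `X` and consequent `Y`. -/
structure RationalEntailment {W : Type v} (N : Set W → Set W → Prop) : Prop where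
  refl : ∀ X, N X X
  conj : ∀ {X Y Z}, N X Y → N X Z → N X (Y ∩ Z)
  weaken : ∀ {X Y Z}, N X Y → Y ⊆ Z → N X Z
  cautious : ∀ {X Y Z}, N X Y → N X Z → N (X ∩ Y) Z
  disj : ∀ {X Y Z}, N X Z → N Y Z → N (X ∪ Y) Z
  rational : ∀ {X Y Z}, ¬ N X Yᶜ → N X Z → N (X ∩ Y) Z

/-- The strongest consequent of `X`: the intersection of all `Y` with `N X Y`. -/
def core {W : Type v} (N : Set W → Set W → Prop) (X : Set W) : Set W := ⋂₀ {Y | N X Y}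

namespace RationalEntailment

variable {W : Type v} [Finite W] {N : Set W → Set W → Prop}

lemma entails_iff_core_subset (hN : RationalEntailment N) {X Y : Set W} :
    N X Y ↔ core N X ⊆ Y := by
  refine ⟨fun h => Set.sInter_subset_of_mem h, fun h => hN.weaken ?_ h⟩
  have (S : Set (Set W)) (hS : S.Finite) (hle : ∀ Y ∈ S, N X Y) : N X (⋂₀ S) := by
    induction S, hS using Set.Finite.induction_on with
    | empty => exact hN.weaken (hN.refl X) (by simp)
    | insert _ _ ih =>
      rw [Set.sInter_insert]
      exact hN.conj (hle _ (by simp)) (ih fun Y hY => hle Y (by simp [hY]))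
  exact this _ (Set.toFinite _) fun _ h => h

lemma entails_core (hN : RationalEntailment N) (X : Set W) : N X (core N X) :=
  hN.entails_iff_core_subset.2 subset_rfl

lemma core_subset (hN : RationalEntailment N) (X : Set W) : core N X ⊆ X :=
  hN.entails_iff_core_subset.1 (hN.refl X)

/-- Arrow's condition on choice functions. -/
lemma core_inter (hN : RationalEntailment N) {X Y : Set W} (h : (core N X ∩ Y).Nonempty) :
    core N (X ∩ Y) = core N X ∩ Y := by
  apply Set.Subset.antisymm
  · refine Set.subset_inter ?_ ((hN.core_subset _).trans Set.inter_subset_right)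
    refine hN.entails_iff_core_subset.1 (hN.rational (fun hne => ?_) (hN.entails_core X))
    obtain ⟨x, hx, hxY⟩ := h
    exact hN.entails_iff_core_subset.1 hne hx hxY
  · -- `core X ⊆ core (X ∩ Y) ∪ core (X \ Y)` by the disjunction property
    have h₁ : N (X ∩ Y) (core N (X ∩ Y) ∪ Yᶜ) := hN.weaken (hN.entails_core _) (by simp)
    have h₂ : N (X \ Y) (core N (X ∩ Y) ∪ Yᶜ) := hN.weaken (hN.refl _) fun x hx => .inr hx.2
    have h₃ := hN.disj h₁ h₂
    rw [Set.inter_union_sdiff, hN.entails_iff_core_subset] at h₃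
    exact fun x hx => (h₃ hx.1).resolve_right fun h => h hx.2

lemma core_eq_inter_of_subset (hN : RationalEntailment N) {X Y : Set W} (hYX : Y ⊆ X)
    (h : (core N X ∩ Y).Nonempty) : core N Y = core N X ∩ Y := by
  rw [← hN.core_inter h, Set.inter_eq_right.2 hYX]

/-- Every state chosen from some set is possible: it is chosen from its singleton. -/
lemma core_singleton_nonempty (hN : RationalEntailment N) {X : Set W} {x : W}
    (hx : x ∈ core N X) : (core N {x}).Nonempty := by
  rw [hN.core_eq_inter_of_subset (Set.singleton_subset_iff.2 (hN.core_subset X hx)) ⟨x, hx, rfl⟩]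
  exact ⟨x, hx, rfl⟩

/-- A set containing a possible state has a nonempty core. -/
lemma core_nonempty (hN : RationalEntailment N) {X : Set W} {x : W} (hx : x ∈ X)
    (h : (core N {x}).Nonempty) : (core N X).Nonempty := by
  rw [Set.nonempty_iff_ne_empty]
  intro he
  -- if `N X ∅`, then `N X {x}`, so cautious monotonicity gives `N {x} ∅`
  have h₀ : N X ∅ := hN.entails_iff_core_subset.2 he.le
  have := hN.cautious (hN.weaken h₀ (Set.empty_subset {x})) h₀
  rw [Set.inter_eq_right.2 (Set.singleton_subset_iff.2 hx), hN.entails_iff_core_subset] at this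
  exact h.ne_empty (Set.subset_empty_iff.1 this)

lemma core_singleton (hN : RationalEntailment N) {x : W} (h : (core N {x}).Nonempty) :
    x ∈ core N {x} := by
  obtain ⟨y, hy⟩ := h
  have hyx : y = x := Set.mem_singleton_iff.1 (hN.core_subset _ hy)
  rwa [hyx] at hy

/-- When `x` is chosen from `X`, a state of `X` is chosen from `X` as soon as it is chosen when
paired with `x`. -/
lemma mem_core_pair_iff (hN : RationalEntailment N) {X : Set W} {x y : W} (hx : x ∈ core N X)
    (hy : y ∈ X) : y ∈ core N {x, y} ↔ y ∈ core N X := by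
  rw [hN.core_eq_inter_of_subset
    (Set.insert_subset (hN.core_subset X hx) (Set.singleton_subset_iff.2 hy)) ⟨x, hx, by simp⟩]
  simp

lemma mem_core_pair (hN : RationalEntailment N) {X : Set W} {x y : W} (hx : x ∈ X)
    (hy : y ∈ core N X) : y ∈ core N {x, y} := by
  rw [hN.core_eq_inter_of_subset
    (Set.insert_subset hx (Set.singleton_subset_iff.2 (hN.core_subset X hy))) ⟨y, hy, by simp⟩]
  simp [hy]

/-- Choosing from the triple `{x, y, z}`. Transitivity and almost connectedness of the revealed
preference `x < y ↔ y ∉ core {x, y}` both follow from this. -/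
lemma exists_core_triple (hN : RationalEntailment N) {x : W} (y z : W) (h : (core N {x}).Nonempty) :
    ∃ X : Set W, x ∈ X ∧ y ∈ X ∧ z ∈ X ∧ (x ∈ core N X ∨ y ∈ core N X ∨ z ∈ core N X) := by
  refine ⟨{x, y, z}, by simp, by simp, by simp, ?_⟩
  obtain ⟨t, ht⟩ := hN.core_nonempty (X := {x, y, z}) (by simp) h
  rcases hN.core_subset _ ht with rfl | rfl | rfl <;> tauto

/-- The relation `N` is given by the truth condition of `▷`, for the revealed preference on the
possible states. -/
lemma entails_iff (hN : RationalEntailment N) {X Y : Set W} :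
    N X Y ↔ ∀ u : {x | (core N {x}).Nonempty}, (u : W) ∈ X →
      ∃ v : {x | (core N {x}).Nonempty}, (v : W) ∈ X ∧
        ∀ z : {x | (core N {x}).Nonempty}, ¬ (z : W) ∉ core N {(v : W), (z : W)} →
          (z : W) ∈ X → (z : W) ∈ Y := by
  rw [hN.entails_iff_core_subset]
  constructor
  · rintro h ⟨u, hu⟩ huX
    obtain ⟨v, hv⟩ := hN.core_nonempty huX hu
    refine ⟨⟨v, hN.core_singleton_nonempty hv⟩, hN.core_subset X hv, fun z hz hzX => h ?_⟩
    exact (hN.mem_core_pair_iff hv hzX).1 (not_not.1 hz)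
  · intro h z hz
    obtain ⟨v, hvX, hv⟩ := h ⟨z, hN.core_singleton_nonempty hz⟩ (hN.core_subset X hz)
    exact hv ⟨z, hN.core_singleton_nonempty hz⟩ (not_not.2 (hN.mem_core_pair hvX hz)) (hN.core_subset X hz)

/-- The model with set of states `W` in which the possible states, ordered by revealed preference,
are attached to every state. -/
def model {AP : Type u} (hN : RationalEntailment N) (val : AP → Set W) : Model AP W where
  dom _ := {x | (core N {x}).Nonempty}
  lt _ x y := (y : W) ∉ core N {(x : W), (y : W)}
  val := val
  lt_irrefl _ x h := h (by simpa using hN.core_singleton x.2)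
  lt_trans := by
    rintro - ⟨x, hx⟩ ⟨y, hy⟩ ⟨z, hz⟩ hxy hyz hxz
    obtain ⟨X, hxX, hyX, hzX, h | h | h⟩ := hN.exists_core_triple y z hx
    · exact hyz (hN.mem_core_pair hyX ((hN.mem_core_pair_iff h hzX).1 hxz))
    · exact hxy (hN.mem_core_pair hxX h)
    · exact hyz (hN.mem_core_pair hyX h)
  lt_almost_connected := by
    rintro - ⟨x, hx⟩ ⟨y, hy⟩ ⟨z, hz⟩ hxy
    by_contra! hne
    obtain ⟨hxz, hzy⟩ := hne
    obtain ⟨X, hxX, hyX, hzX, h⟩ := hN.exists_core_triple y z hx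
    have hz_of_x : x ∈ core N X → z ∈ core N X := fun h => (hN.mem_core_pair_iff h hzX).1 hxz
    have hy_of_z : z ∈ core N X → y ∈ core N X := fun h => (hN.mem_core_pair_iff h hyX).1 hzy
    exact hxy (hN.mem_core_pair hxX (by tauto))

end RationalEntailment

/-! ### Definable sets of valuations -/

section Definability

variable {AP : Type u} {W : Type v} {A : Finset AP}

/-- The state that agrees with the assignment `a` on the atoms in `A`. The states are the subsets
of `A`, listed by `e` in a type that may live in any universe. -/
def stateOf (e : Set A ≃ W) (a : Formula AP → Prop) : W := e {p | a (.atom p)}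

/-- `α` is a propositional formula that defines the set `X` of states: only the values of the
atoms in `A` matter, and `α` is true exactly at the valuations in `X`. -/
def Defines (e : Set A ≃ W) (α : Formula AP) (X : Set W) : Prop :=
  α.IsPropositional ∧ ∀ a, α.TruthFunctional a ↔ stateOf e a ∈ X

variable {e : Set A ≃ W} {α β : Formula AP} {X Y : Set W}

lemma Defines.and (hα : Defines e α X) (hβ : Defines e β Y) :
    Defines e (.and α β) (X ∩ Y) :=
  ⟨⟨hα.1, hβ.1⟩, fun a => and_congr (hα.2 a) (hβ.2 a)⟩

lemma Defines.neg (hα : Defines e α X) : Defines e (.neg α) Xᶜ :=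
  ⟨hα.1, fun a => not_congr (hα.2 a)⟩

lemma Defines.or (hα : Defines e α X) (hβ : Defines e β Y) :
    Defines e (.or α β) (X ∪ Y) :=
  ⟨by simp [hα.1, hβ.1], fun a => by simp [hα.2, hβ.2]⟩

lemma exists_defines_singleton (e : Set A ≃ W) (w : W) : ∃ α, Defines e α {w} := by
  classical
  have key (B : Finset A) : ∃ α : Formula AP, α.IsPropositional ∧
      ∀ a, α.TruthFunctional a ↔ ∀ p ∈ B, (a (.atom p) ↔ p ∈ e.symm w) := by
    induction B using Finset.induction_on with
    | empty => exact ⟨.neg .bot, trivial, fun a => by simp [TruthFunctional]⟩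
    | insert p B _ ih =>
      obtain ⟨α, hα, h⟩ := ih
      by_cases hp : p ∈ e.symm w
      · exact ⟨.and (.atom p) α, ⟨trivial, hα⟩, fun a => by simp [TruthFunctional, h, hp]⟩
      · exact ⟨.and (.neg (.atom p)) α, ⟨trivial, hα⟩, fun a => by
          simp [TruthFunctional, h, hp]⟩
  obtain ⟨α, hα, h⟩ := key Finset.univ
  refine ⟨α, hα, fun a => ?_⟩
  rw [h, Set.mem_singleton_iff, stateOf, ← Equiv.eq_symm_apply, Set.ext_iff]
  simp

lemma exists_defines [Finite W] (e : Set A ≃ W) (X : Set W) : ∃ α, Defines e α X := by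
  induction X, Set.toFinite X using Set.Finite.induction_on with
  | empty => exact ⟨.bot, trivial, fun a => Iff.rfl⟩
  | @insert w _ _ _ ih =>
    obtain ⟨α, hα⟩ := exists_defines_singleton e w
    obtain ⟨β, hβ⟩ := ih
    exact ⟨_, hα.or hβ⟩

/-- The atoms of `φ` lie in `A`. -/
def Formula.AtomsIn (A : Finset AP) : Formula AP → Prop
  | .atom p => p ∈ A
  | .bot => True
  | .neg φ => φ.AtomsIn A
  | .and φ ψ => φ.AtomsIn A ∧ ψ.AtomsIn A
  | .cond φ ψ => φ.AtomsIn A ∧ ψ.AtomsIn A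

lemma Formula.AtomsIn.mono {A B : Finset AP} (hAB : A ⊆ B) {φ : Formula AP} (h : φ.AtomsIn A) :
    φ.AtomsIn B := by
  induction φ with
  | atom p => exact hAB h
  | bot => trivial
  | neg φ ih => exact ih h
  | and φ ψ ih₁ ih₂ => exact ⟨ih₁ h.1, ih₂ h.2⟩
  | cond φ ψ ih₁ ih₂ => exact ⟨ih₁ h.1, ih₂ h.2⟩

lemma Formula.exists_atomsIn (φ : Formula AP) : ∃ A, φ.AtomsIn A := by
  classical
  induction φ with
  | atom p => exact ⟨{p}, Finset.mem_singleton_self p⟩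
  | bot => exact ⟨∅, trivial⟩
  | neg φ ih => exact ih
  | and φ ψ ih₁ ih₂ | cond φ ψ ih₁ ih₂ =>
    obtain ⟨A, hA⟩ := ih₁
    obtain ⟨B, hB⟩ := ih₂
    exact ⟨A ∪ B, hA.mono Finset.subset_union_left, hB.mono Finset.subset_union_right⟩

/-- The states at which the atom `p` is true. Atoms outside `A` are false everywhere. -/
def stateVal (e : Set A ≃ W) (p : AP) : Set W := {w | ∃ h : p ∈ A, ⟨p, h⟩ ∈ e.symm w}

lemma stateOf_mem_stateVal (a : Formula AP → Prop) {p : AP} (hp : p ∈ A) :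
    stateOf e a ∈ stateVal e p ↔ a (.atom p) := by
  simp [stateOf, stateVal, hp]

lemma defines_sat {M : Model AP W} (hM : M.val = stateVal e) (hα : α.IsPropositional)
    (hA : α.AtomsIn A) : Defines e α {w | Sat M w α} := by
  induction α with
  | atom p => exact ⟨trivial, fun a => by
      simp only [Sat, hM, Set.ofPred_mem_eq, TruthFunctional, stateOf_mem_stateVal a hA]⟩
  | bot => exact ⟨trivial, fun a => Iff.rfl⟩
  | neg α ih => simpa [Sat] using! (ih hα hA).neg
  | and α β ih₁ ih₂ => simpa [Sat] using! (ih₁ hα.1 hA.1).and (ih₂ hα.2 hA.2)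
  | cond α β _ _ => exact hα.elim

end Definability

/-! ### The countermodel -/

section Completeness

variable {AP : Type u} {W : Type v} {A : Finset AP} {e : Set A ≃ W} {T : Set (Formula AP)}
  {α β : Formula AP} {X Y : Set W}

/-- The relation between sets of states given by the conditionals in `T`. -/
def Entails (e : Set A ≃ W) (T : Set (Formula AP)) (X Y : Set W) : Prop :=
  ∃ α β, Defines e α X ∧ Defines e β Y ∧ cond α β ∈ T

/-- By the replacement rules, it does not matter which formulas are taken to define two sets. -/
lemma IsTheory.cond_mem_iff_entails (hT : IsTheory T) (hα : Defines e α X)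
    (hβ : Defines e β Y) : cond α β ∈ T ↔ Entails e T X Y := by
  refine ⟨fun h => ⟨α, β, hα, hβ, h⟩, ?_⟩
  rintro ⟨α', β', hα', hβ', h⟩
  have h₁ : iff (cond α' β') (cond α β') ∈ T := by
    refine hT.of_derivable (.replaceAntecedent _ _ _ (.ax _ (.taut _ fun a => ?_) ?_) ?_)
    · simp [hα.2, hα'.2]
    · simp [hα.1.isFlat, hα'.1.isFlat]
    · simp [IsFlat, hα.1, hα'.1, hβ'.1]
  have h₂ : iff (cond α β') (cond α β) ∈ T := by
    refine hT.of_derivable (.replaceConsequent _ _ _ (.ax _ (.taut _ fun a => ?_) ?_) ?_)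
    · simp [hβ.2, hβ'.2]
    · simp [hβ.1.isFlat, hβ'.1.isFlat]
    · simp [IsFlat, hα.1, hβ.1, hβ'.1]
  have h₃ : cond α β' ∈ T := hT.of_truthFunctional₂ h₁ h ⟨hα.1, hβ'.1⟩
    fun a => by rw [truthFunctional_iff]; exact fun h => h.1
  exact hT.of_truthFunctional₂ h₂ h₃ ⟨hα.1, hβ.1⟩
    fun a => by rw [truthFunctional_iff]; exact fun h => h.1

lemma IsCompleteTheory.rationalEntailment [Finite W] (hT : IsCompleteTheory T) (e : Set A ≃ W) :
    RationalEntailment (Entails e T) where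
  refl X := by
    obtain ⟨α, hα⟩ := exists_defines e X
    exact (hT.cond_mem_iff_entails hα hα).1 (hT.of_isAxiom (.refl α) ⟨hα.1, hα.1⟩)
  conj {X Y Z} h₁ h₂ := by
    obtain ⟨α, hα⟩ := exists_defines e X
    obtain ⟨β, hβ⟩ := exists_defines e Y
    obtain ⟨γ, hγ⟩ := exists_defines e Z
    rw [← hT.cond_mem_iff_entails hα hβ] at h₁
    rw [← hT.cond_mem_iff_entails hα hγ] at h₂
    rw [← hT.cond_mem_iff_entails hα (hβ.and hγ)]
    exact hT.mp (hT.and_mem h₁ h₂) (hT.of_isAxiom (.conj α β γ)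
      (by simp [IsFlat, IsPropositional, hα.1, hβ.1, hγ.1]))
  weaken {X Y Z} h hYZ := by
    obtain ⟨α, hα⟩ := exists_defines e X
    obtain ⟨β, hβ⟩ := exists_defines e Y
    obtain ⟨γ, hγ⟩ := exists_defines e Z
    rw [← hT.cond_mem_iff_entails hα hβ] at h
    rw [← Set.union_eq_right.2 hYZ, ← hT.cond_mem_iff_entails hα (hβ.or hγ)]
    exact hT.mp h (hT.of_isAxiom (.weaken α β γ)
      (by simp [IsFlat, hα.1, hβ.1, hγ.1]))
  cautious {X Y Z} h₁ h₂ := by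
    obtain ⟨α, hα⟩ := exists_defines e X
    obtain ⟨β, hβ⟩ := exists_defines e Y
    obtain ⟨γ, hγ⟩ := exists_defines e Z
    rw [← hT.cond_mem_iff_entails hα hβ] at h₁
    rw [← hT.cond_mem_iff_entails hα hγ] at h₂
    rw [← hT.cond_mem_iff_entails (hα.and hβ) hγ]
    exact hT.mp (hT.and_mem h₁ h₂) (hT.of_isAxiom (.cautious α β γ)
      (by simp [IsFlat, IsPropositional, hα.1, hβ.1, hγ.1]))
  disj {X Y Z} h₁ h₂ := by
    obtain ⟨α, hα⟩ := exists_defines e X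
    obtain ⟨β, hβ⟩ := exists_defines e Y
    obtain ⟨γ, hγ⟩ := exists_defines e Z
    rw [← hT.cond_mem_iff_entails hα hγ] at h₁
    rw [← hT.cond_mem_iff_entails hβ hγ] at h₂
    rw [← hT.cond_mem_iff_entails (hα.or hβ) hγ]
    exact hT.mp (hT.and_mem h₁ h₂) (hT.of_isAxiom (.disj α β γ)
      (by simp [IsFlat, hα.1, hβ.1, hγ.1]))
  rational {X Y Z} h₁ h₂ := by
    obtain ⟨α, hα⟩ := exists_defines e X
    obtain ⟨β, hβ⟩ := exists_defines e Y
    obtain ⟨γ, hγ⟩ := exists_defines e Z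
    have hf : (cond α (neg β)).IsFlat := ⟨hα.1, hβ.1⟩
    rw [← hT.cond_mem_iff_entails hα hβ.neg, ← hT.neg_mem_iff hf] at h₁
    rw [← hT.cond_mem_iff_entails hα hγ] at h₂
    rw [← hT.cond_mem_iff_entails (hα.and hβ) hγ]
    exact hT.mp (hT.and_mem h₁ h₂) (hT.of_isAxiom (.rational α β γ)
      (by simp [IsFlat, IsPropositional, hα.1, hβ.1, hγ.1]))

/-- The truth lemma: at the state given by the atoms in `T`, the true flat formulas with atoms in
`A` are those in `T`. -/
lemma IsCompleteTheory.sat_iff_mem [Finite W] (hT : IsCompleteTheory T) (e : Set A ≃ W)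
    {ψ : Formula AP} (hψ : ψ.IsFlat) (hA : ψ.AtomsIn A) :
    Sat ((hT.rationalEntailment e).model (stateVal e)) (stateOf e (· ∈ T)) ψ ↔ ψ ∈ T := by
  induction ψ with
  | atom p => simp only [Sat]; exact stateOf_mem_stateVal _ hA
  | bot =>
    have h : neg .bot ∈ T := hT.of_isAxiom (.taut _ fun a h => h) trivial
    simpa only [Sat, false_iff] using (hT.neg_mem_iff (ψ := .bot) trivial).1 h
  | neg ψ ih => rw [sat_neg, ih hψ hA, hT.neg_mem_iff (ψ := ψ) hψ]
  | and ψ χ ih₁ ih₂ =>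
    rw [sat_and, ih₁ hψ.1 hA.1, ih₂ hψ.2 hA.2]
    exact ⟨fun h => hT.and_mem h.1 h.2, fun h =>
      ⟨hT.of_truthFunctional h hψ.1 fun _ h => h.1, hT.of_truthFunctional h hψ.2 fun _ h => h.2⟩⟩
  | cond α β _ _ =>
    have hM : ((hT.rationalEntailment e).model (stateVal e)).val = stateVal e := rfl
    have hα := defines_sat hM hψ.1 hA.1
    have hβ := defines_sat hM hψ.2 hA.2
    rw [sat_cond, hT.cond_mem_iff_entails hα hβ, (hT.rationalEntailment e).entails_iff]
    rfl

end Completeness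

end VLogic

theorem theorem7 {AP : Type u} [Countable AP] (φ : VLogic.Formula AP)
    (hφ : φ.IsFlat) :
    VLogic.DerivableV1 φ ↔ VLogic.Valid.{u, v} φ := by
  refine ⟨fun h W _ M w => VLogic.sat_of_derivable M h w, fun h => ?_⟩
  by_contra hne
  obtain ⟨T, hT, hφT⟩ := VLogic.exists_isCompleteTheory hφ hne
  obtain ⟨A, hA⟩ := φ.exists_atomsIn
  -- being finite, the type of valuations has a copy in the universe of the models
  let e : Set A ≃ Shrink.{v} (Set A) := equivShrink _
  have : Finite (Shrink.{v} (Set A)) := Finite.of_equiv _ e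
  have : Nonempty (Shrink.{v} (Set A)) := ⟨e ∅⟩
  exact hφT ((hT.sat_iff_mem e hφ hA).1 (h _ _ _))
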